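/- An origami made of $n$ labeled squares is a pair $(\sigma,\tau)$ of permutations of $[n]=\{1,\dots,n\}$: the right side of the unit square labeled $i$ is glued to the left side of the square $\sigma(i)$, and the top side of the square $i$ to the bottom side of the square $\tau(i)$. It is connected if the resulting quotient surface is connected. Let $\mathbb P_n(o\text{ is connected})$ be the proportion of connected origamis among the $(n!)^2$ origamis with $n$ squares. A pair $(<_1,<_2)$ of linear orders of $[k]$ is reducible if $[k]=A\sqcup B$ with $A,B$ nonempty and $a<_1b$, $a<_2b$ for all $a\in A$, $b\in B$; otherwise it is irreducible. A permutation $\sigma$ of $[k]$ is indecomposable if there is no $1\le j<k$ with $\sigma([j])=[j]$. For $k\ge1$ let $\mathfrak{il}_k(2)$ be the number of irreducible pairs of linear orders of $[k]$, let $\mathfrak{ip}_k$ be the number of indecomposable permutations of $[k]$, and let $(n)_k=n(n-1)\cdots(n-k+1)$. Then, as $n\to\infty$, $$\mathbb P_n(o\text{ is connected})\approx 1-\sum_{k\ge1}\frac{\mathfrak{il}_k(2)}{k!\,(n)_k}\qquad\text{and}\qquad \mathbb P_n(o\text{ is connected})\approx 1-\sum_{k\ge1}\frac{\mathfrak{ip}_k}{(n)_k}.$$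 Here $a_n\approx\sum_{k\ge m}f_k(n)$ means that $a_n=\sum_{k=m}^{r}f_k(n)+O(f_{r+1}(n))$ as $n\to\infty$ for every $r\ge m$, and $f_{k+1}(n)=o(f_k(n))$ for every $k\ge m$; it is applied with $m=0$, $f_0(n)=1$, and $f_k(n)=-\mathfrak{il}_k(2)/(k!\,(n)_k)$, respectively $f_k(n)=-\mathfrak{ip}_k/(n)_k$, for $k\ge1$. -/

import Mathlib

open Filter Asymptotics
open scoped Nat

/-- The asymptotic expansion `a n ≈ ∑_{k ≥ m} f k n`, as `n → ∞`: for every `r ≥ m` one has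
`a n = ∑_{k=m}^{r} f k n + O(f (r+1) n)`, and `f (k+1) n = o(f k n)` for every `k ≥ m`. -/
def HasAsymptoticExpansion (a : ℕ → ℝ) (m : ℕ) (f : ℕ → ℕ → ℝ) : Prop :=
  (∀ r, m ≤ r → (fun n => a n - ∑ k ∈ Finset.Icc m r, f k n) =O[atTop] (f (r + 1))) ∧
    ∀ k, m ≤ k → f (k + 1) =o[atTop] (f k)

/-- An origami made of `n` labeled unit squares: the right side of the square `i` is glued to the
left side of the square `right i`, and the top side of `i` to the bottom side of `top i`. -/
structure Origami (n : ℕ) where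
  right : Equiv.Perm (Fin n)
  top : Equiv.Perm (Fin n)

namespace Origami

/-- The identifications of boundary points of the `n` disjoint closed unit squares. -/
inductive Glue {n : ℕ} (o : Origami n) :
    Fin n × unitInterval × unitInterval → Fin n × unitInterval × unitInterval → Prop
  | horizontal (i : Fin n) (y : unitInterval) : Glue o (i, 1, y) (o.right i, 0, y)
  | vertical (i : Fin n) (x : unitInterval) : Glue o (i, x, 1) (o.top i, x, 0)

/-- The square-tiled surface of an origami: the quotient of the disjoint union of the `n` squares
by the equivalence relation generated by the gluings. -/
def Surface {n : ℕ} (o : Origami n) : Type := Quot o.Glue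

/-- The quotient topology. -/
instance {n : ℕ} (o : Origami n) : TopologicalSpace o.Surface :=
  inferInstanceAs (TopologicalSpace (Quot o.Glue))

/-- An origami is connected if its surface is a connected topological space. -/
def IsConnected {n : ℕ} (o : Origami n) : Prop := ConnectedSpace o.Surface

/-- The probability that a uniformly random origami with `n` labeled squares is connected. -/
noncomputable def probConnected (n : ℕ) : ℝ :=
  (Nat.card {o : Origami n // o.IsConnected} : ℝ) / (Nat.card (Origami n) : ℝ)

end Origami

/-- A `d`-multiple linear order of size `n`: a `d`-tuple of linear orders of the ground set. -/
abbrev MultiLinearOrder (d n : ℕ) : Type := Fin d → LinearOrder (Fin n)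

/-- Reducible: there is a partition of the ground set into nonempty parts `A` and `B` such that
every element of `A` is smaller than every element of `B` for each of the `d` orders. -/
def MultiLinearOrder.IsReducible {d n : ℕ} (L : MultiLinearOrder d n) : Prop :=
  ∃ A B : Set (Fin n), A.Nonempty ∧ B.Nonempty ∧ Disjoint A B ∧ A ∪ B = Set.univ ∧
    ∀ a ∈ A, ∀ b ∈ B, ∀ j : Fin d, (L j).lt a b

/-- `𝔦𝔩_n(d)`, the number of irreducible `d`-multiple linear orders of size `n`. -/
noncomputable def numIrreducibleOrders (d n : ℕ) : ℕ :=
  Nat.card {L : MultiLinearOrder d n // ¬ L.IsReducible}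

/-- A permutation `σ` of `n` ordered elements is indecomposable if for no `1 ≤ k < n` it maps
the set of the first `k` elements onto itself. -/
def IsIndecomposable {n : ℕ} (σ : Equiv.Perm (Fin n)) : Prop :=
  ¬ ∃ k : ℕ, 1 ≤ k ∧ k < n ∧ σ '' {i : Fin n | (i : ℕ) < k} = {i : Fin n | (i : ℕ) < k}

/-- `𝔦𝔭_n`, the number of indecomposable permutations of size `n`. -/
noncomputable def numIndecomposable (n : ℕ) : ℕ :=
  Nat.card {σ : Equiv.Perm (Fin n) // IsIndecomposable σ}

/-! Connected origamis are the transitive pairs of permutations. Let t_n be their number and F = ∑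
n! X^n. Splitting a pair of permutations at the orbit of a point gives F' = V F with V = ∑ (n t_n /
n!) X^(n-1) (`factorial_sq_eq_sum_numTransitivePairs`). Splitting a permutation at its first
invariant initial segment gives 1/F = 1 - ∑ ip_k X^k (`invCoeff_eq_ite`). The identity F = 1 + X F +
X² F' links the two: X² V = 1 - X - 1/F, so n t_n / n! = ip_{n+1} exactly for n ≥ 1.

Hence P_n = t_n / n!² = ip_{n+1} / (n · n!), and ip_m has to be expanded. Factorials grow so fast
that only the two ends of the convolution F · (1/F) = 1 matter; this gives ip_m ≈ ∑ c_k (m-k)!,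
where c_k are the coefficients of 1/F² (`isBigO_invCoeff_add_sum`). The differential equation also
gives 1/F² = 1/F + X² (1/F)' - X/F, which makes this sum at m = n+1 equal to n ∑ b_k (n-k)! up to a
boundary term, with b_k the coefficients of 1/F (`sum_invSqCoeff_mul_factorial`). Division by n · n!
leaves ∑ b_k / (n)_k.

A pair of linear orders amounts to a labelling and a relative permutation, so il_k(2) = k! ip_k and
the two expansions coincide term by term. -/

/-! ### Pairs of permutations and their orbits -/

/-- A set is invariant under both permutations of a pair. -/
def PairInvariant {α : Type*} (p : Equiv.Perm α × Equiv.Perm α) (S : Set α) : Prop :=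
  (∀ i, p.1 i ∈ S ↔ i ∈ S) ∧ ∀ i, p.2 i ∈ S ↔ i ∈ S

/-- A pair of permutations is transitive if every nonempty invariant set is everything. -/
def IsTransitivePair {α : Type*} (p : Equiv.Perm α × Equiv.Perm α) : Prop :=
  Nonempty α ∧ ∀ S : Set α, PairInvariant p S → S.Nonempty → S = Set.univ

/-- The orbit of `a`: the smallest invariant set containing `a`. -/
def pairOrbit {α : Type*} (p : Equiv.Perm α × Equiv.Perm α) (a : α) : Set α :=
  {x | ∀ S : Set α, PairInvariant p S → a ∈ S → x ∈ S}

theorem mem_pairOrbit_self {α : Type*} (p : Equiv.Perm α × Equiv.Perm α) (a : α) :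
    a ∈ pairOrbit p a := fun _ _ h => h

theorem pairInvariant_pairOrbit {α : Type*} (p : Equiv.Perm α × Equiv.Perm α) (a : α) :
    PairInvariant p (pairOrbit p a) :=
  ⟨fun i => ⟨fun h S hS ha => (hS.1 i).1 (h S hS ha), fun h S hS ha => (hS.1 i).2 (h S hS ha)⟩,
    fun i => ⟨fun h S hS ha => (hS.2 i).1 (h S hS ha), fun h S hS ha => (hS.2 i).2 (h S hS ha)⟩⟩

theorem IsTransitivePair.permCongr {α β : Type*} (e : α ≃ β) {p : Equiv.Perm α × Equiv.Perm α}
    (hp : IsTransitivePair p) : IsTransitivePair (e.permCongr p.1, e.permCongr p.2) := by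
  refine ⟨hp.1.map e, fun S hS hne => ?_⟩
  have h := hp.2 (e ⁻¹' S) ⟨fun i => ?_, fun i => ?_⟩ ?_
  · rw [← e.image_preimage S, h, Set.image_univ, e.range_eq_univ]
  · simpa using hS.1 (e i)
  · simpa using hS.2 (e i)
  · exact hne.preimage e.surjective

/-- The number of transitive pairs of permutations of a type. -/
noncomputable def numTransitivePairs (α : Type*) : ℕ :=
  Nat.card {p : Equiv.Perm α × Equiv.Perm α // IsTransitivePair p}

theorem numTransitivePairs_congr {α β : Type*} (e : α ≃ β) :
    numTransitivePairs α = numTransitivePairs β := by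
  refine Nat.card_congr ((e.permCongr.prodCongr e.permCongr).subtypeEquiv fun p =>
    ⟨fun h => h.permCongr e, fun h => ?_⟩)
  have := h.permCongr e.symm
  convert this using 1
  refine Prod.ext ?_ ?_ <;> ext x <;> simp

theorem pairInvariant_subtypeCongr {α : Type*} (S : Set α) [DecidablePred (· ∈ S)]
    (q : Equiv.Perm {x // x ∈ S} × Equiv.Perm {x // x ∈ S})
    (r : Equiv.Perm {x // x ∉ S} × Equiv.Perm {x // x ∉ S}) :
    PairInvariant (q.1.subtypeCongr r.1, q.2.subtypeCongr r.2) S := by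
  have key : ∀ (q : Equiv.Perm {x // x ∈ S}) (r : Equiv.Perm {x // x ∉ S}) (i : α),
      q.subtypeCongr r i ∈ S ↔ i ∈ S := by
    intro q r i
    by_cases hi : i ∈ S
    · simp [Equiv.Perm.subtypeCongr.left_apply, hi]
    · simpa [Equiv.Perm.subtypeCongr.right_apply, hi] using (r ⟨i, hi⟩).2
  exact ⟨key _ _, key _ _⟩

/-- Since `S` is invariant under the glued pair, the part `r` on the complement plays no role:
invariance inside `S` is invariance under `q`. -/
theorem pairOrbit_subtypeCongr {α : Type*} (S : Set α) [DecidablePred (· ∈ S)] {a : α} (ha : a ∈ S)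
    {q : Equiv.Perm {x // x ∈ S} × Equiv.Perm {x // x ∈ S}}
    (r : Equiv.Perm {x // x ∉ S} × Equiv.Perm {x // x ∉ S}) :
    pairOrbit (q.1.subtypeCongr r.1, q.2.subtypeCongr r.2) a = S ↔ IsTransitivePair q := by
  have hS := pairInvariant_subtypeCongr S q r
  let p : Equiv.Perm α × Equiv.Perm α := (q.1.subtypeCongr r.1, q.2.subtypeCongr r.2)
  change PairInvariant p S at hS
  change pairOrbit p a = S ↔ _
  have h1 : ∀ x : {x // x ∈ S}, p.1 x = q.1 x := fun x => by
    simp [p, Equiv.Perm.subtypeCongr.left_apply]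
  have h2 : ∀ x : {x // x ∈ S}, p.2 x = q.2 x := fun x => by
    simp [p, Equiv.Perm.subtypeCongr.left_apply]
  constructor
  · intro h
    have key : ∀ T : Set {x // x ∈ S}, PairInvariant q T → ⟨a, ha⟩ ∈ T → T = Set.univ := by
      intro T hT haT
      refine Set.eq_univ_of_forall fun x => ?_
      have hx : (x : α) ∈ pairOrbit p a := h.ge x.2
      have := hx (Subtype.val '' T) ⟨?_, ?_⟩ ⟨_, haT, rfl⟩
      · simpa using this
      · intro i
        by_cases hi : i ∈ S
        · have := hT.1 ⟨i, hi⟩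
          have h1 := h1 ⟨i, hi⟩
          simp only at h1
          simp [h1, hi, this]
        · have : p.1 i ∉ S := fun h => hi ((hS.1 i).1 h)
          simp [hi, this]
      · intro i
        by_cases hi : i ∈ S
        · have := hT.2 ⟨i, hi⟩
          have h1 := h2 ⟨i, hi⟩
          simp only at h1
          simp [h1, hi, this]
        · have : p.2 i ∉ S := fun h => hi ((hS.2 i).1 h)
          simp [hi, this]
    refine ⟨⟨⟨a, ha⟩⟩, fun T hT hne => ?_⟩
    -- The orbit of `a` only controls invariant sets containing `a`; if `T` misses `a`, its
    -- complement is invariant and contains it.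
    by_cases haT : ⟨a, ha⟩ ∈ T
    · exact key T hT haT
    · have := key Tᶜ ⟨fun i => not_congr (hT.1 i), fun i => not_congr (hT.2 i)⟩ haT
      obtain ⟨x, hx⟩ := hne
      exact absurd (this ▸ Set.mem_univ x : x ∈ Tᶜ) (not_not.2 hx)
  · intro hq
    refine Set.Subset.antisymm (fun x hx => hx S hS ha) fun x hx T hT haT => ?_
    have := hq.2 (Subtype.val ⁻¹' T) ⟨fun i => ?_, fun i => ?_⟩ ⟨⟨a, ha⟩, haT⟩
    · exact (this ▸ Set.mem_univ (⟨x, hx⟩ : {x // x ∈ S}) : _ ∈ Subtype.val ⁻¹' T)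
    · simpa [← h1] using hT.1 i
    · simpa [← h2] using hT.2 i

theorem exists_subtypeCongr_eq {α : Type*} (S : Set α) [DecidablePred (· ∈ S)]
    (σ : Equiv.Perm α) (h : ∀ i, σ i ∈ S ↔ i ∈ S) :
    ∃ (q : Equiv.Perm {x // x ∈ S}) (r : Equiv.Perm {x // x ∉ S}), q.subtypeCongr r = σ := by
  refine ⟨σ.subtypePerm h, σ.subtypePerm fun i => not_congr (h i), ?_⟩
  ext i
  by_cases hi : i ∈ S <;> simp [hi]

theorem subtypeCongr_injective {α : Type*} (S : Set α) [DecidablePred (· ∈ S)]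
    {q q' : Equiv.Perm {x // x ∈ S}} {r r' : Equiv.Perm {x // x ∉ S}}
    (h : q.subtypeCongr r = q'.subtypeCongr r') : q = q' ∧ r = r' := by
  have := @Equiv.Perm.subtypeCongrHom_injective α (· ∈ S) _ (q, r) (q', r') h
  exact Prod.ext_iff.1 this

theorem card_pairOrbit_eq {α : Type*} [Fintype α] (a : α) (S : Set α) (ha : a ∈ S) :
    Nat.card {p : Equiv.Perm α × Equiv.Perm α // pairOrbit p a = S} =
      numTransitivePairs (Fin (Nat.card S)) * ((Nat.card α - Nat.card S)! ^ 2) := by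
  classical
  let Φ : {q : Equiv.Perm {x // x ∈ S} × Equiv.Perm {x // x ∈ S} // IsTransitivePair q} ×
      (Equiv.Perm {x // x ∉ S} × Equiv.Perm {x // x ∉ S}) →
      {p : Equiv.Perm α × Equiv.Perm α // pairOrbit p a = S} := fun x =>
    ⟨_, (pairOrbit_subtypeCongr S ha (q := x.1.1) x.2).2 x.1.2⟩
  have hΦ : Function.Bijective Φ := by
    constructor
    · rintro ⟨⟨⟨q1, q2⟩, hq⟩, r1, r2⟩ ⟨⟨⟨q1', q2'⟩, hq'⟩, r1', r2'⟩ h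
      have h' := Prod.ext_iff.1 (Subtype.ext_iff.1 h)
      obtain ⟨rfl, rfl⟩ := subtypeCongr_injective S h'.1
      obtain ⟨rfl, rfl⟩ := subtypeCongr_injective S h'.2
      rfl
    · rintro ⟨⟨σ, τ⟩, h⟩
      have hinv := pairInvariant_pairOrbit (σ, τ) a
      rw [h] at hinv
      obtain ⟨q1, r1, rfl⟩ := exists_subtypeCongr_eq S σ hinv.1
      obtain ⟨q2, r2, rfl⟩ := exists_subtypeCongr_eq S τ hinv.2
      exact ⟨⟨⟨(q1, q2), (pairOrbit_subtypeCongr S ha (r1, r2)).1 h⟩, (r1, r2)⟩, rfl⟩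
  rw [← Nat.card_congr (Equiv.ofBijective Φ hΦ), Nat.card_prod, Nat.card_prod, Nat.card_perm,
    ← numTransitivePairs_congr (Finite.equivFin S), sq]
  have : Nat.card {x // x ∉ S} = Nat.card α - Nat.card S := by
    simp only [Nat.card_eq_fintype_card, Fintype.card_subtype_compl]
  rw [this]
  rfl

/-- Sort the pairs by the orbit of 0, which consists of 0 and k of the other n points; the pair is
transitive on the orbit and arbitrary off it. -/
theorem factorial_sq_eq_sum_numTransitivePairs (n : ℕ) :
    (n + 1)! ^ 2 = ∑ k ∈ Finset.range (n + 1),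
      n.choose k * (numTransitivePairs (Fin (k + 1)) * ((n - k)! ^ 2)) := by
  classical
  have h1 : (n + 1)! ^ 2 = Nat.card (Equiv.Perm (Fin (n + 1)) × Equiv.Perm (Fin (n + 1))) := by
    rw [Nat.card_prod, Nat.card_perm, Nat.card_fin, sq]
  let f : Equiv.Perm (Fin (n + 1)) × Equiv.Perm (Fin (n + 1)) → Finset (Fin (n + 1)) :=
    fun p => ((pairOrbit p 0).toFinset).erase 0
  have h2 : ∀ p ∈ (Finset.univ : Finset (Equiv.Perm (Fin (n + 1)) × Equiv.Perm (Fin (n + 1)))),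
      f p ∈ ((Finset.univ : Finset (Fin (n + 1))).erase 0).powerset := by
    intro p _
    exact Finset.mem_powerset.2 (Finset.erase_subset_erase _ (Finset.subset_univ _))
  have h3 := Finset.sum_powerset_apply_card
    (x := (Finset.univ : Finset (Fin (n + 1))).erase 0) (fun k => numTransitivePairs (Fin (k + 1)) * ((n - k)! ^ 2))
  simp only [Finset.card_erase_of_mem (Finset.mem_univ _), Finset.card_univ, Fintype.card_fin,
    Nat.add_sub_cancel, smul_eq_mul] at h3
  rw [h1, Nat.card_eq_fintype_card, ← Finset.card_univ, Finset.card_eq_sum_card_fiberwise h2, ← h3]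
  refine Finset.sum_congr rfl fun T hT => ?_
  have h0 : (0 : Fin (n + 1)) ∉ T := fun h => by simpa using Finset.mem_powerset.1 hT h
  have h4 := card_pairOrbit_eq (0 : Fin (n + 1)) (insert 0 T : Finset (Fin (n + 1)))
    (by simp)
  rw [Nat.card_eq_card_toFinset, Finset.toFinset_coe, Finset.card_insert_of_notMem h0,
    Nat.card_fin, Nat.add_sub_add_right] at h4
  rw [← h4, Nat.card_eq_fintype_card, Fintype.card_subtype]
  congr 1
  ext p
  simp only [Finset.mem_filter, Finset.mem_univ, true_and, f]
  have hmem : 0 ∈ (pairOrbit p (0 : Fin (n + 1))).toFinset := by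
    simpa using mem_pairOrbit_self p 0
  rw [← Finset.coe_inj (s₁ := Finset.erase _ _)]
  constructor
  · intro h
    rw [Finset.coe_inj] at h
    rw [← h, Finset.insert_erase hmem, Set.coe_toFinset]
  · intro h
    rw [Finset.coe_inj]
    have : (pairOrbit p (0 : Fin (n + 1))).toFinset = insert 0 T := by
      apply Finset.coe_injective
      rw [Set.coe_toFinset, h]
    rw [this, Finset.erase_insert h0]

/-! ### Indecomposable permutations -/

theorem image_eq_iff_forall_mem_iff {α : Type*} [Finite α] (σ : Equiv.Perm α) (S : Set α) :
    σ '' S = S ↔ ∀ i, σ i ∈ S ↔ i ∈ S := by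
  constructor
  · intro h i
    conv_lhs => rw [← h]
    exact σ.injective.mem_set_image
  · intro h
    ext x
    rw [Equiv.image_eq_preimage_symm, Set.mem_preimage, ← h, Equiv.apply_symm_apply]

theorem isIndecomposable_iff {n : ℕ} (σ : Equiv.Perm (Fin n)) :
    IsIndecomposable σ ↔
      ∀ k : ℕ, 1 ≤ k → k < n → ¬ ∀ i, ((σ i : ℕ) < k ↔ (i : ℕ) < k) := by
  simp only [IsIndecomposable, image_eq_iff_forall_mem_iff, Set.mem_ofPred_eq, not_exists, not_and]

theorem numIndecomposable_pos (n : ℕ) : 0 < numIndecomposable n := by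
  have : Nonempty {σ : Equiv.Perm (Fin n) // IsIndecomposable σ} := by
    refine ⟨Fin.revPerm, (isIndecomposable_iff _).2 fun k hk hkn h => ?_⟩
    have := h ⟨0, by omega⟩
    simp only [Fin.revPerm_apply, Fin.val_rev] at this
    omega
  exact Nat.card_pos

theorem numIndecomposable_le (n : ℕ) : numIndecomposable n ≤ n ! := by
  refine (Nat.card_le_card_of_injective _ Subtype.val_injective).trans_eq ?_
  rw [Nat.card_perm, Nat.card_fin]

/-- `Fin k` as the first `k` elements of `Fin n`. -/
def initialEquiv {k n : ℕ} (h : k ≤ n) : Fin k ≃ {x : Fin n // x ∈ {i : Fin n | (i : ℕ) < k}} where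
  toFun i := ⟨Fin.castLE h i, i.2⟩
  invFun i := ⟨i.1, i.2⟩
  left_inv _ := rfl
  right_inv _ := rfl

theorem subtypeCongr_initialEquiv_lt_iff {k n : ℕ} (h : k ≤ n) (q : Equiv.Perm (Fin k))
    (r : Equiv.Perm {x : Fin n // x ∉ {i : Fin n | (i : ℕ) < k}}) {j : ℕ} (hj : j ≤ k) :
    (∀ i, ((((initialEquiv h).permCongr q).subtypeCongr r i : Fin n) : ℕ) < j ↔ (i : ℕ) < j) ↔
      ∀ i, ((q i : ℕ) < j ↔ (i : ℕ) < j) := by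
  constructor
  · intro H i
    have := H (initialEquiv h i)
    rw [Equiv.Perm.subtypeCongr.left_apply_subtype] at this
    simpa [initialEquiv] using this
  · intro H i
    by_cases hi : (i : ℕ) < k
    · have := H ⟨i, hi⟩
      rw [Equiv.Perm.subtypeCongr.left_apply (p := (· ∈ {i : Fin n | (i : ℕ) < k})) _ _ hi]
      simpa [initialEquiv] using this
    · have h1 : ¬ (((r ⟨i, hi⟩ : Fin n) : ℕ) < k) := (r ⟨i, hi⟩).2
      rw [Equiv.Perm.subtypeCongr.right_apply (p := (· ∈ {i : Fin n | (i : ℕ) < k})) _ _ hi]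
      constructor <;> intro <;> omega

theorem card_first_invariant_eq {k n : ℕ} (h : k ≤ n) :
    Nat.card {σ : Equiv.Perm (Fin n) // (∀ i, (σ i : ℕ) < k ↔ (i : ℕ) < k) ∧
      ∀ j : ℕ, 1 ≤ j → j < k → ¬ ∀ i, ((σ i : ℕ) < j ↔ (i : ℕ) < j)} =
      numIndecomposable k * (n - k)! := by
  have hΦ : ∀ x : {q : Equiv.Perm (Fin k) // IsIndecomposable q} ×
      Equiv.Perm {x : Fin n // x ∉ {i : Fin n | (i : ℕ) < k}},
      (∀ i, ((((initialEquiv h).permCongr x.1.1).subtypeCongr x.2 i : Fin n) : ℕ) < k ↔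
        (i : ℕ) < k) ∧ ∀ j : ℕ, 1 ≤ j → j < k →
        ¬ ∀ i, (((((initialEquiv h).permCongr x.1.1).subtypeCongr x.2 i : Fin n) : ℕ) < j ↔
          (i : ℕ) < j) := by
    rintro ⟨⟨q, hq⟩, r⟩
    refine ⟨(subtypeCongr_initialEquiv_lt_iff h q r le_rfl).2 fun i => by simp, fun j h1 hj => ?_⟩
    rw [subtypeCongr_initialEquiv_lt_iff h q r hj.le]
    exact (isIndecomposable_iff q).1 hq j h1 hj
  have hbij : Function.Bijective (fun x => (⟨_, hΦ x⟩ : {σ : Equiv.Perm (Fin n) //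
      (∀ i, (σ i : ℕ) < k ↔ (i : ℕ) < k) ∧
      ∀ j : ℕ, 1 ≤ j → j < k → ¬ ∀ i, ((σ i : ℕ) < j ↔ (i : ℕ) < j)})) := by
    constructor
    · rintro ⟨⟨q, hq⟩, r⟩ ⟨⟨q', hq'⟩, r'⟩ heq
      obtain ⟨h1, rfl⟩ := subtypeCongr_injective _ (Subtype.ext_iff.1 heq)
      obtain rfl := (initialEquiv h).permCongr.injective h1
      rfl
    · rintro ⟨σ, hσ, hmin⟩
      obtain ⟨q, r, rfl⟩ := exists_subtypeCongr_eq {i : Fin n | (i : ℕ) < k} σ hσ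
      obtain ⟨q, rfl⟩ := (initialEquiv h).permCongr.surjective q
      refine ⟨⟨⟨q, (isIndecomposable_iff q).2 fun j h1 hj => ?_⟩, r⟩, rfl⟩
      rw [← subtypeCongr_initialEquiv_lt_iff h q r hj.le]
      exact hmin j h1 hj
  rw [← Nat.card_congr (Equiv.ofBijective _ hbij), Nat.card_prod, Nat.card_perm]
  have : Nat.card {x : Fin n // x ∉ {i : Fin n | (i : ℕ) < k}} = n - k := by
    rw [Nat.card_eq_fintype_card, Fintype.card_subtype_compl,
      ← Fintype.card_congr (initialEquiv h), Fintype.card_fin, Fintype.card_fin]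
  rw [this]
  rfl

/-- Sort permutations by the shortest nonempty initial segment they preserve: minimality makes the
restriction to it indecomposable, and the rest is arbitrary. -/
theorem factorial_eq_sum_numIndecomposable (n : ℕ) :
    (n + 1)! = ∑ k ∈ Finset.range (n + 1), numIndecomposable (k + 1) * (n - k)! := by
  classical
  -- The shift `k + 1` excludes the empty segment; the whole set is always preserved.
  have hex : ∀ σ : Equiv.Perm (Fin (n + 1)),
      ∃ k : ℕ, ∀ i, ((σ i : ℕ) < k + 1 ↔ (i : ℕ) < k + 1) :=
    fun σ => ⟨n, fun i => by simp only [Fin.is_lt]⟩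
  have hmaps : ∀ σ ∈ (Finset.univ : Finset (Equiv.Perm (Fin (n + 1)))),
      Nat.find (hex σ) ∈ Finset.range (n + 1) := fun σ _ =>
    Finset.mem_range.2 (Nat.lt_succ_of_le (Nat.find_min' _ fun i => by simp only [Fin.is_lt]))
  have h1 : (n + 1)! = (Finset.univ : Finset (Equiv.Perm (Fin (n + 1)))).card := by
    rw [Finset.card_univ, Fintype.card_perm, Fintype.card_fin]
  rw [h1, Finset.card_eq_sum_card_fiberwise hmaps]
  refine Finset.sum_congr rfl fun k hk => ?_
  rw [Finset.mem_range] at hk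
  rw [← Nat.add_sub_add_right n 1 k, ← card_first_invariant_eq (by omega),
    Nat.card_eq_fintype_card, Fintype.card_subtype]
  congr 1
  ext σ
  simp only [Finset.mem_filter, Finset.mem_univ, true_and, Nat.find_eq_iff]
  refine and_congr_right fun _ => ⟨fun H j h1 hj => ?_, fun H j hj => H (j + 1) (by omega) (by omega)⟩
  obtain ⟨j, rfl⟩ : ∃ i, j = i + 1 := ⟨j - 1, by omega⟩
  exact H j (by omega)

/-! ### Coefficients of the inverse of the power series of factorials -/

namespace FactorialSeries

open PowerSeries

/-- The power series `∑ n! X ^ n`. -/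
noncomputable def series : PowerSeries ℝ := PowerSeries.mk fun n => (n ! : ℝ)

/-- The coefficients of the inverse of `∑ n! X ^ n`. -/
noncomputable def invCoeff (n : ℕ) : ℝ := coeff n series⁻¹

/-- The coefficients of the squared inverse of `∑ n! X ^ n`. -/
noncomputable def invSqCoeff (n : ℕ) : ℝ := coeff n (series⁻¹ * series⁻¹)

theorem series_mul_inv : series * series⁻¹ = 1 :=
  PowerSeries.mul_inv_cancel _ (by simp [series])

theorem eq_inv_of_mul_series_eq_one {f : PowerSeries ℝ} (h : f * series = 1) : f = series⁻¹ := by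
  linear_combination series⁻¹ * h - f * series_mul_inv

/-- Coefficientwise this is (n+1)! = n! + n · n!. -/
theorem series_eq : series = 1 + X * series + X * (X * derivative ℝ series) := by
  ext n
  rcases n with _ | _ | n
  · simp [series]
  · simp [series, coeff_one]
  · simp only [map_add, coeff_one, coeff_succ_X_mul, coeff_derivative, series, coeff_mk]
    rw [Nat.factorial_succ (n + 1)]
    push_cast
    simp
    ring

theorem inv_eq : series⁻¹ = 1 - X - X * (X * derivative ℝ series) * series⁻¹ := by
  linear_combination (-series⁻¹) * series_eq + (1 - X) * series_mul_inv

/-- Multiply `inv_eq` by 1/F and recognise -F'/F² as (1/F)'. -/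
theorem inv_sq_eq :
    series⁻¹ * series⁻¹ = series⁻¹ + X * (X * derivative ℝ series⁻¹) - X * series⁻¹ := by
  have h := derivative_inv' series
  rw [h]
  linear_combination (series⁻¹) * inv_eq

theorem invCoeff_zero : invCoeff 0 = 1 := by
  simp [invCoeff, series]

theorem invSqCoeff_zero : invSqCoeff 0 = 1 := by
  simp [invSqCoeff, series]

theorem invSqCoeff_succ (k : ℕ) :
    invSqCoeff (k + 1) = invCoeff (k + 1) + ((k : ℝ) - 1) * invCoeff k := by
  rw [invSqCoeff, inv_sq_eq]
  rcases k with _ | k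
  · simp [invCoeff, coeff_succ_X_mul, sub_eq_add_neg]
  · simp only [map_add, map_sub, coeff_succ_X_mul, coeff_derivative, invCoeff]
    push_cast
    ring

theorem sum_invCoeff_mul_factorial {m : ℕ} (hm : m ≠ 0) :
    ∑ k ∈ Finset.range (m + 1), invCoeff k * ((m - k)! : ℝ) = 0 := by
  have h := congrArg (coeff m) series_mul_inv
  rw [mul_comm, coeff_mul, Finset.Nat.sum_antidiagonal_eq_sum_range_succ_mk, coeff_one,
    if_neg hm] at h
  simpa [series, invCoeff] using h

theorem invCoeff_eq_sum_invSqCoeff (k : ℕ) :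
    invCoeff k = ∑ j ∈ Finset.range (k + 1), (j ! : ℝ) * invSqCoeff (k - j) := by
  have h : series * (series⁻¹ * series⁻¹) = series⁻¹ := by
    linear_combination series⁻¹ * series_mul_inv
  have h := congrArg (coeff k) h
  rw [coeff_mul, Finset.Nat.sum_antidiagonal_eq_sum_range_succ_mk] at h
  simpa [series, invCoeff, invSqCoeff] using h.symm

/-- If `X F' = V F` for the factorial series `F`, the coefficients of `V` are those of `-1/F`,
shifted. -/
theorem eq_neg_invCoeff_succ {v : ℕ → ℝ}
    (h : ∀ n : ℕ, (n + 1 : ℝ) * ((n + 1)! : ℝ) =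
      ∑ k ∈ Finset.range (n + 1), v (k + 1) * ((n - k)! : ℝ)) (n : ℕ) :
    v (n + 1) = -invCoeff (n + 2) := by
  have h1 : derivative ℝ series = PowerSeries.mk (fun k => v (k + 1)) * series := by
    ext n
    rw [coeff_mul, Finset.Nat.sum_antidiagonal_eq_sum_range_succ_mk, coeff_derivative]
    simp only [series, coeff_mk]
    rw [← h n, mul_comm]
  have h2 : PowerSeries.mk (fun k => v (k + 1)) = derivative ℝ series * series⁻¹ := by
    linear_combination (-series⁻¹) * h1 -
      PowerSeries.mk (fun k => v (k + 1)) * series_mul_inv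
  have h3 : X * (X * PowerSeries.mk (fun k => v (k + 1))) = 1 - X - series⁻¹ := by
    linear_combination X * X * h2 + inv_eq
  have h4 := congrArg (coeff (n + 2)) h3
  simpa [coeff_succ_X_mul, coeff_one, coeff_X, invCoeff] using h4

/-! ### Factorial estimates and asymptotics of the coefficients -/

theorem factorial_mul_factorial_le (s x y : ℕ) : (s + x)! * (s + y)! ≤ s ! * (s + x + y)! := by
  induction x with
  | zero => simp
  | succ x ih =>
    calc (s + (x + 1))! * (s + y)! = (s + x + 1) * ((s + x)! * (s + y)!) := by
          rw [← add_assoc, Nat.factorial_succ]; ring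
      _ ≤ (s + x + y + 1) * (s ! * (s + x + y)!) := Nat.mul_le_mul (by omega) ih
      _ = s ! * (s + (x + 1) + y)! := by
          rw [show s + (x + 1) + y = s + x + y + 1 by ring, Nat.factorial_succ (s + x + y)]; ring

/-- By log-convexity the products shrink towards the middle. The two end terms give 2 · R! (m-R)!;
each inner term is at most (R+1)! (m-R-1)!, and there are fewer than m-R of them. -/
theorem sum_factorial_mul_factorial_le {R m : ℕ} (h : 2 * R ≤ m) :
    ∑ k ∈ Finset.Ico R (m - R + 1), k ! * (m - k)! ≤ (2 * R ! + (R + 1)!) * (m - R)! := by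
  obtain ⟨d, rfl⟩ := Nat.exists_eq_add_of_le h
  rcases d with _ | d
  · rw [show 2 * R + 0 - R = R by omega]
    simp only [Nat.Ico_succ_singleton, Finset.sum_singleton]
    rw [show 2 * R + 0 - R = R by omega]
    nlinarith [Nat.zero_le (R ! * R !), Nat.zero_le ((R + 1)! * R !)]
  have e1 : 2 * R + (d + 1) - R = R + d + 1 := by omega
  rw [e1, Finset.sum_Ico_succ_top (by omega), Finset.sum_eq_sum_Ico_succ_bot (by omega), e1,
    show 2 * R + (d + 1) - (R + d + 1) = R by omega]
  have hmid : ∑ k ∈ Finset.Ico (R + 1) (R + d + 1), k ! * (2 * R + (d + 1) - k)! ≤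
      (R + 1)! * (R + d + 1)! := by
    calc _ ≤ ∑ k ∈ Finset.Ico (R + 1) (R + d + 1), (R + 1)! * (R + d)! := by
          refine Finset.sum_le_sum fun k hk => ?_
          rw [Finset.mem_Ico] at hk
          have := factorial_mul_factorial_le (R + 1) (k - (R + 1)) (R + d - k)
          rwa [show R + 1 + (k - (R + 1)) = k by omega,
            show R + 1 + (R + d - k) = 2 * R + (d + 1) - k by omega,
            show k + (R + d - k) = R + d by omega] at this
      _ = d * ((R + 1)! * (R + d)!) := by
          rw [Finset.sum_const, Nat.card_Ico, smul_eq_mul]; congr 1; omega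
      _ ≤ (R + d + 1) * ((R + 1)! * (R + d)!) := Nat.mul_le_mul_right _ (by omega)
      _ = (R + 1)! * (R + d + 1)! := by rw [Nat.factorial_succ (R + d)]; ring
  nlinarith

/-- Expansion of the coefficients of `1/F` in terms of those of `1/F ^ 2`. -/
theorem isBigO_invCoeff_add_sum (hb : ∀ k, |invCoeff k| ≤ k !) (R : ℕ) :
    (fun m => invCoeff m + ∑ k ∈ Finset.range R, invSqCoeff k * ((m - k)! : ℝ)) =O[atTop]
      fun m => ((m - R)! : ℝ) := by
  induction R using Nat.strong_induction_on with
  | _ R ih =>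
  rcases Nat.eq_zero_or_pos R with rfl | hR
  · refine IsBigO.of_bound 1 (Eventually.of_forall fun m => ?_)
    simpa using hb m
  -- The terms k = m - j near the top of the convolution contain `invCoeff (m - j)`, which the
  -- induction hypothesis expands to order `R - j`; the errors are all (m-R)!.
  have hends : (fun m => ∑ j ∈ Finset.Ico 1 R, (j ! : ℝ) *
      (invCoeff (m - j) + ∑ k ∈ Finset.range (R - j), invSqCoeff k * ((m - j - k)! : ℝ)))
      =O[atTop] fun m => ((m - R)! : ℝ) := by
    refine IsBigO.fun_sum fun j hj => IsBigO.const_mul_left ?_ _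
    rw [Finset.mem_Ico] at hj
    have := (ih (R - j) (by omega)).comp_tendsto (tendsto_sub_atTop_nat j)
    refine this.congr' (Eventually.of_forall fun m => rfl) (Eventually.of_forall fun m => ?_)
    simp only [Function.comp]
    rw [show m - j - (R - j) = m - R by omega]
  have hmid : (fun m => ∑ k ∈ Finset.Ico R (m - R + 1), invCoeff k * ((m - k)! : ℝ))
      =O[atTop] fun m => ((m - R)! : ℝ) := by
    refine IsBigO.of_bound ((2 * R ! + (R + 1)! : ℕ) : ℝ) ?_
    filter_upwards [eventually_ge_atTop (2 * R)] with m hm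
    rw [Real.norm_eq_abs, Real.norm_of_nonneg (by positivity)]
    calc _ ≤ ∑ k ∈ Finset.Ico R (m - R + 1), (k ! : ℝ) * ((m - k)! : ℝ) := by
          refine (Finset.abs_sum_le_sum_abs _ _).trans (Finset.sum_le_sum fun k _ => ?_)
          rw [abs_mul, Nat.abs_cast]
          exact mul_le_mul_of_nonneg_right (hb k) (by positivity)
      _ ≤ _ := by exact_mod_cast sum_factorial_mul_factorial_le hm
  refine (hmid.add hends).neg_left.congr' ?_ EventuallyEq.rfl
  filter_upwards [eventually_ge_atTop (2 * R)] with m hm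
  have hsum := sum_invCoeff_mul_factorial (m := m) (by omega)
  rw [Finset.sum_range_succ, Nat.sub_self, Nat.factorial_zero, Nat.cast_one, mul_one,
    Finset.range_eq_Ico, ← Finset.sum_Ico_consecutive _ (Nat.zero_le R) (by omega : R ≤ m),
    ← Finset.sum_Ico_consecutive _ (by omega : R ≤ m - R + 1) (by omega : m - R + 1 ≤ m)] at hsum
  have hrefl : ∑ k ∈ Finset.Ico (m - R + 1) m, invCoeff k * ((m - k)! : ℝ) =
      ∑ j ∈ Finset.Ico 1 R, (j ! : ℝ) * invCoeff (m - j) := by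
    refine Finset.sum_bij' (fun k _ => m - k) (fun j _ => m - j) ?_ ?_ ?_ ?_ ?_ <;>
      intro k hk <;> simp only [Finset.mem_Ico] at hk ⊢
    · omega
    · omega
    · omega
    · omega
    · rw [show m - (m - k) = k by omega, mul_comm]
  -- Writing 1/F as F · (1/F²) regroups the head of the convolution by j. The part j = 0 is the
  -- claimed expansion; the parts j ≥ 1 pair with the expansions in `hends`.
  have hexp : ∑ k ∈ Finset.Ico 0 R, invCoeff k * ((m - k)! : ℝ) =
      ∑ k ∈ Finset.range R, invSqCoeff k * ((m - k)! : ℝ) + ∑ j ∈ Finset.Ico 1 R, (j ! : ℝ) *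
        ∑ k ∈ Finset.range (R - j), invSqCoeff k * ((m - j - k)! : ℝ) := by
    have : ∑ k ∈ Finset.range R, invSqCoeff k * ((m - k)! : ℝ) = ((0 : ℕ)! : ℝ) *
        ∑ k ∈ Finset.range (R - 0), invSqCoeff k * ((m - 0 - k)! : ℝ) := by simp
    rw [this, ← Finset.sum_eq_sum_Ico_succ_bot hR (fun j => (j ! : ℝ) *
        ∑ k ∈ Finset.range (R - j), invSqCoeff k * ((m - j - k)! : ℝ))]
    simp only [← Finset.range_eq_Ico]
    simp only [Finset.mul_sum]
    simp only [invCoeff_eq_sum_invSqCoeff, Finset.sum_mul]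
    rw [Finset.sum_sigma', Finset.sum_sigma']
    refine Finset.sum_bij' (fun x _ => ⟨x.2, x.1 - x.2⟩) (fun x _ => ⟨x.1 + x.2, x.1⟩) ?_ ?_ ?_ ?_ ?_
      <;> rintro ⟨k, j⟩ hk <;> simp only [Finset.mem_sigma, Finset.mem_range] at hk ⊢
    · omega
    · omega
    · simp; omega
    · simp
    · rw [show m - j - (k - j) = m - k by omega, mul_assoc]
  rw [hrefl, hexp] at hsum
  simp only [mul_add, Finset.sum_add_distrib]
  linarith

/-- By `invSqCoeff_succ`, `invCoeff k * (n - k)!` is collected with weight n + 1 - k from index k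
and k - 1 from index k + 1, in total n. Only the term of index r + 1 stays unpaired. -/
theorem sum_invSqCoeff_mul_factorial {n r : ℕ} (h : r ≤ n) :
    ∑ k ∈ Finset.range (r + 2), invSqCoeff k * ((n + 1 - k)! : ℝ) =
      n * ∑ k ∈ Finset.range (r + 1), invCoeff k * ((n - k)! : ℝ) +
        invCoeff (r + 1) * ((n - r)! : ℝ) := by
  induction r with
  | zero =>
    simp [Finset.sum_range_succ, invSqCoeff_succ, invSqCoeff_zero, invCoeff_zero,
      Nat.factorial_succ]
    ring
  | succ r ih =>
    rw [Finset.sum_range_succ, ih (by omega), Finset.sum_range_succ _ (r + 1), invSqCoeff_succ,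
      show n + 1 - (r + 2) = n - (r + 1) by omega, show n - r = n - (r + 1) + 1 by omega,
      Nat.factorial_succ]
    push_cast [Nat.cast_sub h]
    ring

/-- Expansion of the coefficients of `log F`. -/
theorem isBigO_sub_sum_invCoeff (hb : ∀ k, |invCoeff k| ≤ k !) {w : ℕ → ℝ}
    (hw : ∀ n : ℕ, ((n + 1 : ℕ) : ℝ) * w (n + 1) = -invCoeff (n + 2)) (r : ℕ) :
    (fun n => w n - ∑ k ∈ Finset.range (r + 1), invCoeff k * ((n - k)! : ℝ)) =O[atTop]
      fun n => ((n - (r + 1))! : ℝ) := by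
  -- At m = n + 1 and order r + 2 the error is (n-r-1)!; after division by n, both it and the
  -- boundary term are within the required bound.
  have h1 := ((isBigO_invCoeff_add_sum hb (r + 2)).comp_tendsto (tendsto_add_atTop_nat 1))
  have h2 : (fun n : ℕ => invCoeff (r + 1) * ((n - r)! : ℝ)) =O[atTop]
      fun n => (n : ℝ) * ((n - (r + 1))! : ℝ) := by
    refine IsBigO.const_mul_left (IsBigO.of_bound 1 ?_) _
    filter_upwards [eventually_ge_atTop (r + 1)] with n hn
    rw [Real.norm_of_nonneg (by positivity), Real.norm_of_nonneg (by positivity), one_mul,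
      show n - r = n - (r + 1) + 1 by omega, Nat.factorial_succ]
    push_cast [Nat.cast_sub hn]
    gcongr
    linarith [(Nat.cast_nonneg r : (0 : ℝ) ≤ r)]
  have h3 : (fun n : ℕ => ((n + 1 - (r + 2))! : ℝ)) =O[atTop]
      fun n => (n : ℝ) * ((n - (r + 1))! : ℝ) := by
    refine IsBigO.of_bound 1 ?_
    filter_upwards [eventually_ge_atTop 1] with n hn
    rw [Real.norm_of_nonneg (by positivity), Real.norm_of_nonneg (by positivity), one_mul,
      show n + 1 - (r + 2) = n - (r + 1) by omega]
    have : (1 : ℝ) ≤ n := by exact_mod_cast hn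
    nlinarith [(Nat.cast_nonneg (n - (r + 1))! : (0 : ℝ) ≤ _)]
  have h4 := ((h1.trans h3).neg_left.add h2)
  have h5 := (isBigO_refl (fun n : ℕ => (n : ℝ)⁻¹) atTop).mul h4
  refine h5.congr' ?_ ?_
  · filter_upwards [eventually_ge_atTop (r + 1)] with n hn
    obtain ⟨n, rfl⟩ : ∃ k, n = k + 1 := ⟨n - 1, by omega⟩
    have hn0 : ((n + 1 : ℕ) : ℝ) ≠ 0 := by positivity
    have := sum_invSqCoeff_mul_factorial (n := n + 1) (r := r) (by omega)
    simp only [Function.comp]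
    rw [this, ← neg_neg (invCoeff (n + 1 + 1)), ← hw n]
    field_simp
    ring
  · filter_upwards [eventually_ge_atTop 1] with n hn
    have hn0 : (n : ℝ) ≠ 0 := by positivity
    field_simp

end FactorialSeries

/-! ### Connectedness of the surface -/

namespace Origami

/-- The squares labelled by an invariant set form a clopen part of the surface. -/
theorem isTransitivePair_of_isConnected {n : ℕ} {o : Origami n} (h : o.IsConnected) :
    IsTransitivePair (o.right, o.top) := by
  have : ConnectedSpace o.Surface := h
  refine ⟨?_, fun S hS hne => ?_⟩
  · obtain ⟨⟨p⟩⟩ := this.toNonempty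
    exact ⟨p.1⟩
  · have hglue : ∀ a b, o.Glue a b → (a.1 ∈ S) = (b.1 ∈ S) := by
      rintro _ _ (⟨i, y⟩ | ⟨i, x⟩)
      · exact propext (hS.1 i).symm
      · exact propext (hS.2 i).symm
    let U : Set o.Surface := {x | Quot.lift (fun p => p.1 ∈ S) hglue x}
    have hU : IsClopen U := by
      have hq : Topology.IsQuotientMap (Quot.mk o.Glue) := isQuotientMap_quot_mk
      have : IsClopen (Quot.mk o.Glue ⁻¹' U) :=
        (isClopen_discrete S).preimage
          (continuous_fst : Continuous (Prod.fst : Fin n × unitInterval × unitInterval → Fin n))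
      exact hq.isClopen_preimage.1 this
    obtain ⟨i, hi⟩ := hne
    have hU' : U = Set.univ := hU.eq_univ ⟨Quot.mk _ (i, 0, 0), hi⟩
    refine Set.eq_univ_of_forall fun j => ?_
    have : (Quot.mk _ (j, 0, 0) : o.Surface) ∈ U := hU' ▸ Set.mem_univ _
    exact this

theorem isConnected_of_isTransitivePair {n : ℕ} {o : Origami n}
    (h : IsTransitivePair (o.right, o.top)) : o.IsConnected := by
  let q : Fin n → unitInterval × unitInterval → o.Surface := fun i z => Quot.mk _ (i, z)
  have hq : ∀ i, Continuous (q i) := fun i =>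
    (continuous_quot_mk (r := o.Glue)).comp (by fun_prop)
  have hc : ∀ i z z', connectedComponent (q i z) = connectedComponent (q i z') := by
    intro i z z'
    exact (connectedComponent_eq ((isPreconnected_range (hq i)).subset_connectedComponent
      ⟨z, rfl⟩ ⟨z', rfl⟩))
  -- Each square has connected image, so one glued corner per edge suffices to link components.
  have hright : ∀ i, q i (1, 0) = q (o.right i) (0, 0) := fun i => Quot.sound (.horizontal i 0)
  have htop : ∀ i, q i (0, 1) = q (o.top i) (0, 0) := fun i => Quot.sound (.vertical i 0)
  obtain ⟨⟨a⟩, h⟩ := h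
  have hS : {i | connectedComponent (q i (0, 0)) = connectedComponent (q a (0, 0))} = Set.univ := by
    refine h _ ⟨fun i => ?_, fun i => ?_⟩ ⟨a, rfl⟩
    · simp only [Set.mem_ofPred_eq]
      rw [← hright i, hc i (1, 0) (0, 0)]
    · simp only [Set.mem_ofPred_eq]
      rw [← htop i, hc i (0, 1) (0, 0)]
  have hall : ∀ x : o.Surface, connectedComponent x = connectedComponent (q a (0, 0)) := by
    rintro ⟨i, z⟩
    have hi : i ∈ {i | connectedComponent (q i (0, 0)) = connectedComponent (q a (0, 0))} :=
      hS ▸ Set.mem_univ i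
    exact (hc i z (0, 0)).trans hi
  have hpre : PreconnectedSpace o.Surface := by
    refine preconnectedSpace_iff_connectedComponent.2 fun x => Set.eq_univ_of_forall fun y => ?_
    rw [hall x, ← hall y]
    exact mem_connectedComponent
  exact @ConnectedSpace.mk _ _ hpre ⟨q a (0, 0)⟩

/-- An origami is a pair of permutations. -/
def equivPair (n : ℕ) : Origami n ≃ Equiv.Perm (Fin n) × Equiv.Perm (Fin n) where
  toFun o := (o.right, o.top)
  invFun p := ⟨p.1, p.2⟩
  left_inv _ := rfl
  right_inv _ := rfl

theorem probConnected_eq (n : ℕ) :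
    probConnected n = (numTransitivePairs (Fin n) : ℝ) / (n ! : ℝ) ^ 2 := by
  have h1 : Nat.card (Origami n) = n ! ^ 2 := by
    rw [Nat.card_congr (equivPair n), Nat.card_prod, Nat.card_perm, Nat.card_fin, sq]
  have h2 : Nat.card {o : Origami n // o.IsConnected} = numTransitivePairs (Fin n) :=
    Nat.card_congr ((equivPair n).subtypeEquiv fun _ =>
      ⟨isTransitivePair_of_isConnected, isConnected_of_isTransitivePair⟩)
  rw [probConnected, h1, h2, Nat.cast_pow]

end Origami

/-! ### Pairs of linear orders -/

theorem exists_equiv_fin_lt_iff {α : Type*} [Fintype α] [LinearOrder α] {k : ℕ}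
    (h : Fintype.card α = k) : ∃ e : α ≃ Fin k, ∀ a b, e a < e b ↔ a < b :=
  ⟨(monoEquivOfFin α h).symm.toEquiv, fun _ _ => (monoEquivOfFin α h).symm.lt_iff_lt⟩

/-- The linear order on `Fin k` in which `a` has position `π a`. -/
abbrev permOrder {k : ℕ} (π : Equiv.Perm (Fin k)) : LinearOrder (Fin k) :=
  LinearOrder.lift' π π.injective

theorem permOrder_lt {k : ℕ} (π : Equiv.Perm (Fin k)) (a b : Fin k) :
    (permOrder π).lt a b ↔ π a < π b := Iff.rfl

theorem permOrder_bijective (k : ℕ) :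
    Function.Bijective (permOrder : Equiv.Perm (Fin k) → LinearOrder (Fin k)) := by
  constructor
  · intro π π' h
    have hlt : ∀ a b, π a < π b ↔ π' a < π' b := fun a b => by
      rw [← permOrder_lt, ← permOrder_lt, h]
    have hle : ∀ a b, π a ≤ π b ↔ π' a ≤ π' b := fun a b => by
      rw [← not_lt, ← not_lt, hlt]
    let e : Fin k ≃o Fin k := ⟨π.symm.trans π', fun {a b} => by simp [← hle]⟩
    have he : e = OrderIso.refl _ := Subsingleton.elim _ _
    ext a
    have := congrArg (fun f : Fin k ≃o Fin k => f (π a)) he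
    simpa [e] using (congrArg Fin.val this).symm
  · intro L
    obtain ⟨e, he⟩ := @exists_equiv_fin_lt_iff (Fin k) _ L k (Fintype.card_fin k)
    exact ⟨e, LinearOrder.ext_lt fun a b => he a b⟩

/-- The elements placed before the `π`-least element of `B` are exactly those of `A`, so its
position is the size of `A`. -/
theorem image_eq_setOf_lt_ncard {k : ℕ} (π : Equiv.Perm (Fin k)) {A B : Set (Fin k)}
    (hA : A.Nonempty) (hB : B.Nonempty) (hAB : A ∪ B = Set.univ)
    (h : ∀ a ∈ A, ∀ b ∈ B, π a < π b) :
    1 ≤ A.ncard ∧ A.ncard < k ∧ π '' A = {i : Fin k | (i : ℕ) < A.ncard} := by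
  obtain ⟨b, hb, hmin⟩ := B.toFinite.exists_minimalFor π B hB
  have him : π '' A = {i : Fin k | (i : ℕ) < π b} := by
    ext i
    constructor
    · rintro ⟨a, ha, rfl⟩
      exact h a ha b hb
    · intro hi
      have hi' : i < π b := hi
      rcases (hAB ▸ Set.mem_univ (π.symm i) : π.symm i ∈ A ∪ B) with hi2 | hi2
      · exact ⟨_, hi2, by simp⟩
      · have := hmin hi2
        simp only [Equiv.apply_symm_apply] at this
        exact absurd (this hi'.le) (not_le.2 hi')
  have hcard : A.ncard = π b := by
    rw [← Set.ncard_image_of_injective A π.injective, him]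
    have : {i : Fin k | (i : ℕ) < π b} = (Finset.Iio (π b) : Set (Fin k)) := by
      ext i; simp
    rw [this, Set.ncard_coe_finset, Fin.card_Iio]
  refine ⟨(Set.ncard_pos).2 hA, hcard ▸ (π b).2, hcard ▸ him⟩

/-- `σ` sends positions in the first order to positions in the second, so a common initial segment
`A` of both orders is an initial segment of positions preserved by `σ`. -/
theorem isReducible_iff {k : ℕ} (π σ : Equiv.Perm (Fin k)) :
    MultiLinearOrder.IsReducible (d := 2) ![permOrder π, permOrder (π.trans σ)] ↔
      ¬ IsIndecomposable σ := by
  rw [IsIndecomposable, not_not]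
  constructor
  · rintro ⟨A, B, hA, hB, -, hAB, h⟩
    obtain ⟨h1, h2, h3⟩ := image_eq_setOf_lt_ncard π hA hB hAB fun a ha b hb => h a ha b hb 0
    obtain ⟨-, -, h4⟩ := image_eq_setOf_lt_ncard (π.trans σ) hA hB hAB
      fun a ha b hb => h a ha b hb 1
    refine ⟨_, h1, h2, ?_⟩
    conv_lhs => rw [← h3]
    rw [← h4, Set.image_image]
    rfl
  · rintro ⟨j, h1, h2, h3⟩
    rw [image_eq_iff_forall_mem_iff] at h3
    simp only [Set.mem_ofPred_eq] at h3
    refine ⟨{a | (π a : ℕ) < j}, {a | ¬ (π a : ℕ) < j}, ⟨π.symm ⟨0, by omega⟩, ?_⟩,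
      ⟨π.symm ⟨j, h2⟩, ?_⟩, ?_, ?_, ?_⟩
    · simpa using Nat.pos_of_ne_zero (by omega)
    · simp
    · exact Set.disjoint_left.2 fun a ha hb => hb ha
    · exact Set.eq_univ_of_forall fun a => em _
    · intro a ha b hb i
      rw [Set.mem_ofPred_eq] at ha hb
      have ha' := (h3 (π a)).2 ha
      have hb' := mt (h3 (π b)).1 hb
      fin_cases i
      · change (π a : ℕ) < π b
        omega
      · change (σ (π a) : ℕ) < σ (π b)
        omega

theorem numIrreducibleOrders_two (k : ℕ) :
    numIrreducibleOrders 2 k = k ! * numIndecomposable k := by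
  let Φ : Equiv.Perm (Fin k) × {σ : Equiv.Perm (Fin k) // IsIndecomposable σ} →
      {L : MultiLinearOrder 2 k // ¬ L.IsReducible} := fun x =>
    ⟨![permOrder x.1, permOrder (x.1.trans x.2.1)],
      fun h => (isReducible_iff _ _).1 h x.2.2⟩
  have hΦ : Function.Bijective Φ := by
    constructor
    · rintro ⟨π, σ, hσ⟩ ⟨π', σ', hσ'⟩ h
      have h := Subtype.ext_iff.1 h
      obtain rfl : π = π' := (permOrder_bijective k).1 (congrFun h 0)
      have h1 : π.trans σ = π.trans σ' := (permOrder_bijective k).1 (congrFun h 1)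
      obtain rfl : σ = σ' := by
        ext i
        simpa using congrArg (fun f : Equiv.Perm (Fin k) => (f (π.symm i) : ℕ)) h1
      rfl
    · rintro ⟨L, hL⟩
      obtain ⟨π, hπ⟩ := (permOrder_bijective k).2 (L 0)
      obtain ⟨ρ, hρ⟩ := (permOrder_bijective k).2 (L 1)
      have hL' : L = ![permOrder π, permOrder (π.trans (π.symm.trans ρ))] := by
        have : π.trans (π.symm.trans ρ) = ρ := by ext; simp
        rw [this, hπ, hρ]
        ext1 i
        fin_cases i <;> rfl
      subst hL'
      exact ⟨⟨π, π.symm.trans ρ, not_not.1 fun h => hL ((isReducible_iff _ _).2 h)⟩, rfl⟩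
  rw [numIrreducibleOrders, ← Nat.card_congr (Equiv.ofBijective Φ hΦ), Nat.card_prod,
    Nat.card_perm, Nat.card_fin]
  rfl

/-! ### The asymptotic expansions -/

open FactorialSeries in
-- The recursion for indecomposable permutations is the coefficient form of (1/F) · F = 1. Index 0
-- is separate: the empty permutation counts as indecomposable, but the constant coefficient is +1.
theorem invCoeff_eq_ite (k : ℕ) :
    invCoeff k = if k = 0 then 1 else -(numIndecomposable k : ℝ) := by
  have h : PowerSeries.mk (fun k => if k = 0 then (1 : ℝ) else -(numIndecomposable k : ℝ)) *
      series = 1 := by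
    ext n
    rw [PowerSeries.coeff_mul, Finset.Nat.sum_antidiagonal_eq_sum_range_succ_mk,
      PowerSeries.coeff_one]
    rcases n with _ | n
    · simp [series]
    · have := congrArg (Nat.cast : ℕ → ℝ) (factorial_eq_sum_numIndecomposable n)
      push_cast at this
      rw [Finset.sum_range_succ']
      simp [series, this]
  rw [invCoeff, ← eq_inv_of_mul_series_eq_one h, PowerSeries.coeff_mk]

open FactorialSeries in
theorem abs_invCoeff_le (k : ℕ) : |invCoeff k| ≤ k ! := by
  rw [invCoeff_eq_ite]
  split_ifs with h
  · simp [h]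
  · rw [abs_neg, Nat.abs_cast]
    exact_mod_cast numIndecomposable_le k

/-- The number of transitive pairs is `(n - 1)!` times the number of indecomposable permutations of
`n + 1` elements. -/
theorem succ_mul_numTransitivePairs_div (n : ℕ) :
    ((n + 1 : ℕ) : ℝ) * ((numTransitivePairs (Fin (n + 1)) : ℝ) / ((n + 1)! : ℝ)) =
      -FactorialSeries.invCoeff (n + 2) := by
  refine FactorialSeries.eq_neg_invCoeff_succ
    (v := fun n => (n : ℝ) * ((numTransitivePairs (Fin n) : ℝ) / (n ! : ℝ))) (fun n => ?_) n
  have h := congrArg (Nat.cast : ℕ → ℝ) (factorial_sq_eq_sum_numTransitivePairs n)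
  push_cast at h
  have hn : (n ! : ℝ) ≠ 0 := by positivity
  -- Dividing the orbit recursion by n! absorbs the binomial coefficient and turns it into F' = V F.
  have h1 : (n + 1 : ℝ) * ((n + 1)! : ℝ) = ((n + 1)! : ℝ) ^ 2 / n ! := by
    rw [Nat.factorial_succ]
    push_cast
    field_simp
  rw [h1, h, Finset.sum_div]
  refine Finset.sum_congr rfl fun k hk => ?_
  have hk : k ≤ n := Nat.lt_succ_iff.1 (Finset.mem_range.1 hk)
  rw [Nat.cast_choose ℝ hk, Nat.factorial_succ k]
  push_cast
  field_simp

theorem Origami.hasAsymptoticExpansion_invCoeff :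
    HasAsymptoticExpansion Origami.probConnected 0
      fun k n => FactorialSeries.invCoeff k / (n.descFactorial k : ℝ) := by
  have hdiv : ∀ {n k : ℕ}, k ≤ n → ((n - k)! : ℝ) / n ! = 1 / (n.descFactorial k : ℝ) := by
    intro n k h
    rw [← Nat.factorial_mul_descFactorial h]
    push_cast
    field_simp
  -- Nonvanishing coefficients are needed because errors are measured against the next term,
  -- coefficient included.
  have hne : ∀ k, FactorialSeries.invCoeff k ≠ 0 := by
    intro k
    rw [invCoeff_eq_ite]
    split_ifs
    · exact one_ne_zero
    · exact neg_ne_zero.2 (Nat.cast_ne_zero.2 (numIndecomposable_pos k).ne')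
  constructor
  · intro r _
    have h := FactorialSeries.isBigO_sub_sum_invCoeff abs_invCoeff_le
      (w := fun n => (numTransitivePairs (Fin n) : ℝ) / (n ! : ℝ))
      succ_mul_numTransitivePairs_div r
    have h2 := (h.mul (isBigO_refl (fun n : ℕ => ((n ! : ℕ) : ℝ)⁻¹) atTop)).trans
      (isBigO_self_const_mul (hne (r + 1)) _ _)
    refine h2.congr' ?_ ?_
    · filter_upwards [eventually_ge_atTop r] with n hn
      rw [Origami.probConnected_eq, ← div_eq_mul_inv, sub_div, Finset.sum_div, div_div, ← sq,
        Finset.range_eq_Ico]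
      congr 1
      refine Finset.sum_congr rfl fun k hk => ?_
      rw [mul_div_assoc, hdiv (by have := (Finset.mem_Ico.1 hk).2; omega), mul_one_div]
    · filter_upwards [eventually_ge_atTop (r + 1)] with n hn
      rw [← div_eq_mul_inv, hdiv hn, mul_one_div]
  · intro k _
    have h : Tendsto (fun n : ℕ => ((n - k : ℕ) : ℝ)⁻¹) atTop (nhds 0) :=
      tendsto_inv_atTop_zero.comp (tendsto_natCast_atTop_atTop.comp (tendsto_sub_atTop_nat k))
    have h1 : (fun n : ℕ => ((n - k : ℕ) : ℝ)⁻¹ * (n.descFactorial k : ℝ)⁻¹) =o[atTop]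
        fun n => (1 : ℝ) * (n.descFactorial k : ℝ)⁻¹ :=
      ((isLittleO_one_iff ℝ).2 h).mul_isBigO (isBigO_refl _ _)
    refine ((h1.const_mul_left (FactorialSeries.invCoeff (k + 1))).trans_isBigO
      (isBigO_self_const_mul (hne k) _ _)).congr (fun n => ?_) fun n => ?_
    · beta_reduce
      rw [Nat.descFactorial_succ, Nat.cast_mul, div_eq_mul_inv, mul_inv]
    · beta_reduce
      rw [one_mul, div_eq_mul_inv]

theorem mainTheorem7 :
    HasAsymptoticExpansion Origami.probConnected 0
        (fun k n => if k = 0 then 1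
          else -((numIrreducibleOrders 2 k : ℝ) / ((k ! : ℝ) * (n.descFactorial k : ℝ)))) ∧
      HasAsymptoticExpansion Origami.probConnected 0
        (fun k n => if k = 0 then 1
          else -((numIndecomposable k : ℝ) / (n.descFactorial k : ℝ))) := by
  have h1 : (fun k n : ℕ => FactorialSeries.invCoeff k / (n.descFactorial k : ℝ)) =
      fun k n => if k = 0 then 1
        else -((numIndecomposable k : ℝ) / (n.descFactorial k : ℝ)) := by
    funext k n
    rw [invCoeff_eq_ite]
    split_ifs with h
    · simp [h]
    · rw [neg_div]
  have h2 : (fun k n : ℕ => if k = 0 then (1 : ℝ)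
        else -((numIrreducibleOrders 2 k : ℝ) / ((k ! : ℝ) * (n.descFactorial k : ℝ)))) =
      fun k n => if k = 0 then 1
        else -((numIndecomposable k : ℝ) / (n.descFactorial k : ℝ)) := by
    funext k n
    rw [numIrreducibleOrders_two, Nat.cast_mul, mul_div_mul_left _ _ (by positivity)]
  have h := Origami.hasAsymptoticExpansion_invCoeff
  rw [h1] at h
  exact ⟨h2 ▸ h, h⟩
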